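/- Let $n\ge 1$, $e\ge 0$ and $t>1$ be integers and let $q=(2e+1)t$. Equip $\mathbb{Z}_q$ with the Lee distance (the distance on the cycle graph with vertex set $\mathbb{Z}_q$) and $\mathbb{Z}_q^n$ with the maximum metric $d(x,y)=\max_i d(x_i,y_i)$; let $B(x,r)$ be the ball of radius $r$ around $x$. A linear perfect $(n,e,q)$-code is a subgroup $C\le\mathbb{Z}_q^n$ with $\#C>1$ whose packing radius (the greatest $r$ such that the balls $B(c,r)$, $c\in C$, are pairwise disjoint) and covering radius (the least $r$ such that these balls cover $\mathbb{Z}_q^n$) are both equal to $e$. Write $e_1,\dots,e_n$ for the standard basis vectors. A set $S\subseteq\mathbb{Z}_q^n$ is of type $i$ if $S+(2e+1)e_i\subseteq S$. For $I\subseteq\{1,\dots,n\}$ let $H_I=\{x: x_i=0\ \forall i\in I\}$, let $\pi_I$ be the map replacing the coordinates in $I$ by $0$, and let $C\langle I\rangle=\pi_I\big(C\cap\bigcup_{h\in H_I}B(h,e)\big)$. The code $C$ is ordered if its associated permutation $(\wp_1,\dots,\wp_n)$, given recursively by $\wp_k=\max\{i: C\langle\{\wp_1,\dots,\wp_{k-1}\}\rangle\text{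 is of type }i\}$, is $(n,n-1,\dots,1)$. Let $LPL^\infty(n,e,q)_o$ be the set of ordered linear perfect $(n,e,q)$-codes. The pair $(e,q)$ is called $n$-maximal if $\#LPL^\infty(n,e,q)_o=(2e+1)^{\binom n2}$. Let $\nabla_n(2e+1)_{\mathrm{red}}$ be the set of upper triangular integer $n\times n$ matrices $M$ with $M_{ii}=2e+1$ for all $i$ and $|M_{ij}|\le e$ for $i<j$, and let $\mathrm{span}(M)\le\mathbb{Z}^n$ be the subgroup generated by the rows of $M$. Let $\Gamma_n$ be the group of integer $n\times n$ matrices of determinant $\pm1$; call $A,B$ $\Gamma_n$-equivalent if $A=UBV$ for some $U,V\in\Gamma_n$. Call two codes $C_1,C_2$ algebraically equivalent if $C_1=f(C_2)$ for some group automorphism $f$ of $\mathbb{Z}_q^n$, and write $[C]_{\mathcal A}$ for the class of $C$. Theorem. Suppose that $(e,q)$ is $n$-maximal. Then $q\mathbb{Z}^n\subseteq\mathrm{span}(M)$ for every $M\in\nabla_n(2e+1)_{\mathrm{red}}$, the map $$\psi:\nabla_n(2e+1)_{\mathrm{red}}\to LPL^\infty(n,e,q)_o,\qquad \psi(M)=\mathrm{span}(M)/q\mathbb{Z}^n,$$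 is a well-defined bijection, and it induces a well-defined bijection $$\psi_{\mathcal A}:\ \nabla_n(2e+1)_{\mathrm{red}}/\Gamma_n\ \to\ LPL^\infty(n,e,q)_o/\mathcal A,\qquad \psi_{\mathcal A}([M])=[\psi(M)]_{\mathcal A},$$ where the quotients are by $\Gamma_n$-equivalence and by algebraic equivalence. -/

import Mathlib

namespace MaxMetricCode

section Codes

variable {n q : ℕ}

/-- The distance on the cycle graph with vertex set `ZMod q` (the Lee distance): the least absolute
value of an integer representing `x - y`. -/
def leeDist (x y : ZMod q) : ℕ := (x - y).valMinAbs.natAbs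

/-- With representatives in `{0, …, q - 1}` the Lee distance is `min {|x - y|, q - |x - y|}`. -/
theorem leeDist_eq_min [NeZero q] (x y : ZMod q) :
    (leeDist x y : ℤ) =
      min |(x.val : ℤ) - (y.val : ℤ)| ((q : ℤ) - |(x.val : ℤ) - (y.val : ℤ)|) := by
  have hx := ZMod.val_lt x
  have hy := ZMod.val_lt y
  rw [leeDist, ZMod.valMinAbs_natAbs_eq_min]
  rcases le_total y.val x.val with h | h
  · rw [ZMod.val_sub h, abs_of_nonneg (by omega)]
    omega
  · rcases h.eq_or_lt with h | h
    · have : x = y := ZMod.val_injective q h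
      subst this
      simp
    · have h1 : (x - y).val = q - (y.val - x.val) := by
        have h2 : (y - x).val = y.val - x.val := ZMod.val_sub h.le
        have h3 : y - x ≠ 0 := by
          intro h0
          rw [h0, ZMod.val_zero] at h2
          omega
        have : NeZero (y - x) := ⟨h3⟩
        rw [← neg_sub y x, ZMod.val_neg_of_ne_zero, h2]
      rw [h1, abs_of_neg (by omega)]
      omega

/-- The maximum (Chebyshev) distance on `(ZMod q) ^ n`. -/
def maxDist (x y : Fin n → ZMod q) : ℕ := Finset.univ.sup fun i => leeDist (x i) (y i)

/-- The ball `B(x, r)` in the maximum metric. -/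
def ball (x : Fin n → ZMod q) (r : ℕ) : Set (Fin n → ZMod q) := {y | maxDist x y ≤ r}

/-- `r` is the packing radius of `C`: the greatest `r` for which the balls of radius `r` around the
codewords are pairwise disjoint. -/
def IsPackingRadius (C : Set (Fin n → ZMod q)) (r : ℕ) : Prop :=
  IsGreatest {r : ℕ | C.PairwiseDisjoint fun c => ball c r} r

/-- `r` is the covering radius of `C`: the least `r` for which the balls of radius `r` around the
codewords cover the whole space. -/
def IsCoveringRadius (C : Set (Fin n → ZMod q)) (r : ℕ) : Prop :=
  IsLeast {r : ℕ | (⋃ c ∈ C, ball c r) = Set.univ} r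

/-- `C` is a perfect `(n, e, q)`-code: it has more than one codeword, and its packing radius and its
covering radius are both equal to `e`. -/
def IsPerfectCode (e : ℕ) (C : Set (Fin n → ZMod q)) : Prop :=
  C.Nontrivial ∧ IsPackingRadius C e ∧ IsCoveringRadius C e

/-- `S` is of type `i`: `S + (2e+1) e_i ⊆ S`. -/
def IsOfType (e : ℕ) (S : Set (Fin n → ZMod q)) (i : Fin n) : Prop :=
  ∀ c ∈ S, c + Pi.single i ((2 * e + 1 : ℕ) : ZMod q) ∈ S

/-- The cartesian subgroup `H_I = {x | x_i = 0 for all i ∈ I}`. -/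
def cartesianSubgroup (I : Finset (Fin n)) : Set (Fin n → ZMod q) := {x | ∀ i ∈ I, x i = 0}

/-- The orthogonal projection onto `H_I`: it replaces the coordinates in `I` by zero. -/
def orthProj (I : Finset (Fin n)) (x : Fin n → ZMod q) : Fin n → ZMod q :=
  fun i => if i ∈ I then 0 else x i

/-- The generalized ball `B(H, e)`, the union of the balls `B(h, e)` with `h ∈ H`. -/
def genBall (H : Set (Fin n → ZMod q)) (e : ℕ) : Set (Fin n → ZMod q) := ⋃ h ∈ H, ball h e

/-- The cartesian section `C⟨I⟩`, the projection onto `H_I` of `B(H_I, e) ∩ C`. -/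
def cartesianSection (e : ℕ) (C : Set (Fin n → ZMod q)) (I : Finset (Fin n)) :
    Set (Fin n → ZMod q) :=
  orthProj I '' (genBall (cartesianSubgroup I) e ∩ C)

/-- `p = (p_1, …, p_n)` is the sequence associated with `C`: for each `k`, the entry `p_k` is the
greatest `i` such that the cartesian section of `C` with respect to `{p_j | j < k}` is of type `i`
(for the first entry this is the section with respect to `∅`, which is `C` itself). -/
def IsAssociatedSequence (e : ℕ) (C : Set (Fin n → ZMod q)) (p : Fin n → Fin n) : Prop :=
  ∀ k : Fin n,
    IsGreatest {i : Fin n | IsOfType e (cartesianSection e C ((Finset.Iio k).image p)) i} (p k)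

variable (n q)

/-- The linear perfect `(n, e, q)`-codes. -/
def linearPerfectCodes (e : ℕ) : Set (AddSubgroup (Fin n → ZMod q)) :=
  {C | IsPerfectCode e (C : Set (Fin n → ZMod q))}

/-- The ordered linear perfect `(n, e, q)`-codes: those whose associated sequence is
`(n, n - 1, …, 1)`. -/
def orderedCodes (e : ℕ) : Set (AddSubgroup (Fin n → ZMod q)) :=
  {C | C ∈ linearPerfectCodes n q e ∧
    IsAssociatedSequence e (C : Set (Fin n → ZMod q)) Fin.rev}

/-- The pair `(e, q)` is `n`-maximal: the number of ordered linear perfect `(n, e, q)`-codes attains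
the upper bound `(2e+1) ^ (n choose 2)`. -/
def IsMaximalPair (e : ℕ) : Prop :=
  Nat.card (orderedCodes n q e) = (2 * e + 1) ^ n.choose 2

/-- Algebraic equivalence of ordered codes: `C₁ = f(C₂)` for an automorphism `f` of the group
`(ZMod q) ^ n`. -/
def algSetoid (e : ℕ) : Setoid (orderedCodes n q e) where
  r C₁ C₂ := ∃ f : (Fin n → ZMod q) ≃+ (Fin n → ZMod q),
    (C₁ : AddSubgroup (Fin n → ZMod q)) =
      (C₂ : AddSubgroup (Fin n → ZMod q)).map f.toAddMonoidHom
  iseqv :=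
    { refl := fun C => ⟨AddEquiv.refl _, by ext x; simp⟩
      symm := by
        rintro C₁ C₂ ⟨f, h⟩
        refine ⟨f.symm, ?_⟩
        rw [h]
        ext x
        simp
      trans := by
        rintro C₁ C₂ C₃ ⟨f, h⟩ ⟨g, h'⟩
        refine ⟨g.trans f, ?_⟩
        rw [h, h']
        ext x
        simp }

end Codes

section Matrices

variable (n : ℕ)

/-- The reduced upper triangular integer `n × n` matrices with all diagonal entries equal to
`2e+1`: the entries above the diagonal have absolute value at most `e`. -/
def reducedMatrices (e : ℕ) : Set (Matrix (Fin n) (Fin n) ℤ) :=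
  {M | (∀ i j, j < i → M i j = 0) ∧ (∀ i, M i i = 2 * (e : ℤ) + 1) ∧
    ∀ i j, i < j → |M i j| ≤ (e : ℤ)}

variable {n}

/-- The subgroup of `ℤ ^ n` generated by the rows of `M`. -/
def rowSpan (M : Matrix (Fin n) (Fin n) ℤ) : AddSubgroup (Fin n → ℤ) :=
  AddSubgroup.closure (Set.range M.row)

/-- The coordinatewise reduction `ℤ ^ n → (ZMod q) ^ n`. -/
def reduction (n q : ℕ) : (Fin n → ℤ) →+ (Fin n → ZMod q) :=
  (Int.castAddHom (ZMod q)).compLeft (Fin n)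

/-- An integer matrix is unimodular if its determinant is `1` or `-1`. -/
def IsUnimodular (U : Matrix (Fin n) (Fin n) ℤ) : Prop := U.det = 1 ∨ U.det = -1

theorem isUnimodular_iff (U : Matrix (Fin n) (Fin n) ℤ) : IsUnimodular U ↔ IsUnit U.det :=
  Int.isUnit_iff.symm

/-- Two-sided unimodular equivalence: `A = U B V` with `U` and `V` unimodular. -/
def GammaEquiv (A B : Matrix (Fin n) (Fin n) ℤ) : Prop :=
  ∃ U V : Matrix (Fin n) (Fin n) ℤ, IsUnimodular U ∧ IsUnimodular V ∧ A = U * B * V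

variable (n)

/-- Two-sided unimodular equivalence, restricted to the reduced matrices. -/
def gammaSetoid (e : ℕ) : Setoid (reducedMatrices n e) where
  r A B := GammaEquiv (A : Matrix (Fin n) (Fin n) ℤ) (B : Matrix (Fin n) (Fin n) ℤ)
  iseqv :=
    { refl := fun A => ⟨1, 1, by simp [IsUnimodular], by simp [IsUnimodular], by simp⟩
      symm := by
        rintro A B ⟨U, V, hU, hV, h⟩
        rw [isUnimodular_iff] at hU hV
        refine ⟨U⁻¹, V⁻¹, ?_, ?_, ?_⟩
        · rw [isUnimodular_iff]
          exact Matrix.isUnit_nonsing_inv_det U hU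
        · rw [isUnimodular_iff]
          exact Matrix.isUnit_nonsing_inv_det V hV
        · rw [h, Matrix.mul_assoc U, Matrix.nonsing_inv_mul_cancel_left _ _ hU,
            Matrix.mul_nonsing_inv_cancel_right _ _ hV]
      trans := by
        rintro A B C ⟨U, V, hU, hV, h⟩ ⟨U', V', hU', hV', h'⟩
        rw [isUnimodular_iff] at hU hV hU' hV'
        refine ⟨U * U', V' * V, ?_, ?_, ?_⟩
        · rw [isUnimodular_iff, Matrix.det_mul]
          exact hU.mul hU'
        · rw [isUnimodular_iff, Matrix.det_mul]
          exact hV'.mul hV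
        · rw [h, h']
          simp only [Matrix.mul_assoc] }

end Matrices

end MaxMetricCode

namespace MaxMetricCode

open Matrix

variable {n : ℕ}

/-! The preimage in `ℤ^n` of an ordered code is the row span of a reduced matrix: orderedness
supplies the rows, and disjointness of the balls shows that they generate
(`exists_reducedMatrix_of_ordered`). This embeds the ordered codes into the reduced matrices, of
which there are `(2e+1)^(n choose 2)`. Maximality makes the embedding bijective, and `ψ` is its
inverse; as a preimage, each span contains `qℤ^n`.

For the quotients, a unimodular matrix reduces to an automorphism modulo `q`. Conversely, an
automorphism need not lift, since its determinant is only a unit modulo `q`. In a Smith basis of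
`ℤ^n` for one span it becomes a diagonal matrix times the reduction of a unimodular one
(`exists_eq_diagonal_mul_map`). The diagonal factor only rescales basis vectors, which preserves
that span, so the unimodular factor does the same work (`exists_unimodular_rowSpan_eq`). -/

theorem mem_rowSpan {M : Matrix (Fin n) (Fin n) ℤ} {v : Fin n → ℤ} :
    v ∈ rowSpan M ↔ ∃ x : Fin n → ℤ, x ᵥ* M = v := by
  constructor
  · intro hv
    induction hv using AddSubgroup.closure_induction with
    | mem v hv =>
      obtain ⟨i, rfl⟩ := hv
      exact ⟨Pi.single i 1, by simp⟩
    | zero => exact ⟨0, by simp⟩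
    | add v w _ _ hv hw =>
      obtain ⟨x, rfl⟩ := hv
      obtain ⟨y, rfl⟩ := hw
      exact ⟨x + y, Matrix.add_vecMul _ _ _⟩
    | neg v _ hv =>
      obtain ⟨x, rfl⟩ := hv
      exact ⟨-x, Matrix.neg_vecMul _ _⟩
  · rintro ⟨x, rfl⟩
    rw [Matrix.vecMul_eq_sum]
    exact AddSubgroup.sum_mem _ fun i _ =>
      AddSubgroup.zsmul_mem (rowSpan M) (AddSubgroup.subset_closure (Set.mem_range_self i)) _

theorem row_mem_rowSpan (M : Matrix (Fin n) (Fin n) ℤ) (i : Fin n) : M i ∈ rowSpan M :=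
  AddSubgroup.subset_closure ⟨i, rfl⟩

@[simp]
theorem reduction_apply (q : ℕ) (v : Fin n → ℤ) (i : Fin n) :
    reduction n q v i = (v i : ZMod q) := rfl

theorem reduction_surjective (n q : ℕ) : Function.Surjective (reduction n q) := fun x => by
  choose v hv using fun i => ZMod.intCast_surjective (x i)
  exact ⟨v, funext hv⟩

/-! ### From ordered codes to reduced matrices -/

theorem leeDist_zero_intCast_le {q e : ℕ} [NeZero q] {a : ℤ} (ha : |a| ≤ e) :
    leeDist (0 : ZMod q) (a : ZMod q) ≤ e := by
  rw [leeDist, zero_sub, ZMod.natAbs_valMinAbs_neg]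
  refine (ZMod.natAbs_min_of_le_div_two q _ a (by simp) (ZMod.natAbs_valMinAbs_le _)).trans ?_
  zify
  exact ha

theorem exists_abs_sub_mul_le (e : ℕ) (a : ℤ) : ∃ m : ℤ, |a - m * (2 * e + 1)| ≤ e := by
  -- Adding `e` before the floor division rounds to the nearest multiple.
  refine ⟨(a + e) / (2 * e + 1), ?_⟩
  have h1 := Int.emod_add_mul_ediv (a + e) (2 * e + 1)
  have h2 := Int.emod_nonneg (a + e) (b := 2 * e + 1) (by omega)
  have h3 := Int.emod_lt_of_pos (a + e) (b := 2 * e + 1) (by omega)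
  rw [abs_le]
  constructor <;> linarith

/-- Division with remainder, from left to right: row `k` vanishes before column `k`, so correcting
coordinate `k` leaves the earlier ones untouched. -/
theorem exists_vecMul_abs_sub_le {e : ℕ} {M : Matrix (Fin n) (Fin n) ℤ}
    (hM : M ∈ reducedMatrices n e) (v : Fin n → ℤ) :
    ∃ x : Fin n → ℤ, ∀ j, |(v - x ᵥ* M) j| ≤ e := by
  suffices h : ∀ k ≤ n, ∃ x : Fin n → ℤ, ∀ j : Fin n, j.1 < k → |(v - x ᵥ* M) j| ≤ e by
    obtain ⟨x, hx⟩ := h n le_rfl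
    exact ⟨x, fun j => hx j j.2⟩
  intro k
  induction k with
  | zero => exact fun _ => ⟨0, fun j hj => absurd hj (Nat.not_lt_zero _)⟩
  | succ k ih =>
    intro hk
    obtain ⟨x, hx⟩ := ih (by omega)
    obtain ⟨m, hm⟩ := exists_abs_sub_mul_le e ((v - x ᵥ* M) ⟨k, hk⟩)
    refine ⟨x + Pi.single ⟨k, hk⟩ m, fun j hj => ?_⟩
    have key : (v - (x + Pi.single ⟨k, hk⟩ m) ᵥ* M) j = (v - x ᵥ* M) j - m * M ⟨k, hk⟩ j := by
      rw [Matrix.add_vecMul, Matrix.single_vecMul]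
      simp [sub_sub]
    rw [key]
    rcases Nat.lt_succ_iff_lt_or_eq.1 hj with h | h
    · rw [hM.1 ⟨k, hk⟩ j (Fin.lt_def.2 h), mul_zero, sub_zero]
      exact hx j h
    · obtain rfl : j = ⟨k, hk⟩ := Fin.ext h
      rw [hM.2.1]
      exact hm

/-- The section for `{j | i < j}` contains `0` and is of type `i`, so it contains `(2e+1)e_i`. A
codeword projecting to that point, lifted suitably, is the row. -/
theorem exists_row_of_ordered {q e : ℕ} {C : AddSubgroup (Fin n → ZMod q)}
    (hC : C ∈ orderedCodes n q e) (i : Fin n) :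
    ∃ r : Fin n → ℤ, reduction n q r ∈ C ∧ (∀ j < i, r j = 0) ∧ r i = 2 * (e : ℤ) + 1 ∧
      ∀ j, i < j → |r j| ≤ e := by
  have hI : (Finset.Iio i.rev).image Fin.rev = Finset.Ioi i := by
    ext j
    simp only [Finset.mem_image, Finset.mem_Iio, Finset.mem_Ioi]
    constructor
    · rintro ⟨a, ha, rfl⟩
      exact Fin.lt_rev_iff.2 ha
    · exact fun h => ⟨j.rev, Fin.rev_lt_rev.2 h, Fin.rev_rev j⟩
  have h0 := (hC.2 i.rev).1
  rw [hI, Fin.rev_rev] at h0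
  have hzero : (0 : Fin n → ZMod q) ∈ cartesianSection e (C : Set (Fin n → ZMod q))
      (Finset.Ioi i) := by
    refine ⟨0, ⟨Set.mem_biUnion (x := 0) (fun _ _ => rfl) ?_, C.zero_mem⟩, ?_⟩
    · simp [ball, maxDist, leeDist]
    · ext; simp [orthProj]
  obtain ⟨c, ⟨hball, hc⟩, hproj⟩ := h0 0 hzero
  rw [zero_add] at hproj
  simp only [genBall, Set.mem_iUnion] at hball
  obtain ⟨h, hh, hb⟩ := hball
  have hp : ∀ j ≤ i, c j = (Pi.single i ((2 * e + 1 : ℕ) : ZMod q) : Fin n → ZMod q) j := by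
    intro j hj
    rw [← hproj, orthProj, if_neg (by simpa using hj)]
  -- Coordinates up to `i` get prescribed lifts; later ones get the least absolute representative,
  -- whose size is the Lee distance to `0`.
  refine ⟨fun j => if j < i then 0 else if j = i then 2 * e + 1 else (c j).valMinAbs,
    ?_, ?_, ?_, ?_⟩
  · refine (congrArg (· ∈ C) (funext fun j => ?_)).mpr hc
    simp only [reduction_apply]
    split_ifs with h1 h2
    · rw [hp j h1.le, Pi.single_eq_of_ne h1.ne]; simp
    · subst h2
      rw [hp j le_rfl]; simp
    · simp
  · intro j hj
    simp [hj]
  · simp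
  · intro j hj
    have h1 : leeDist (h j) (c j) ≤ e :=
      (Finset.le_sup (f := fun i => leeDist (h i) (c i)) (Finset.mem_univ j)).trans hb
    rw [hh j (by simpa using hj), leeDist, zero_sub, ZMod.natAbs_valMinAbs_neg] at h1
    simp only [not_lt.2 hj.le, hj.ne', if_false]
    zify at h1
    exact h1

theorem exists_reducedMatrix_of_ordered {q e t : ℕ} (ht : 1 < t) (hq : q = (2 * e + 1) * t)
    {C : AddSubgroup (Fin n → ZMod q)} (hC : C ∈ orderedCodes n q e) :
    ∃ M ∈ reducedMatrices n e, rowSpan M = C.comap (reduction n q) := by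
  choose M hMC hM0 hM1 hM2 using exists_row_of_ordered hC
  have hM : M ∈ reducedMatrices n e := ⟨fun i j h => hM0 i j h, hM1, hM2⟩
  have hqe : e < q := by
    rw [hq]; nlinarith
  have : NeZero q := ⟨by omega⟩
  have hle : rowSpan M ≤ C.comap (reduction n q) := by
    refine (AddSubgroup.closure_le _).2 ?_
    rintro _ ⟨i, rfl⟩
    exact hMC i
  refine ⟨M, hM, le_antisymm hle fun v hv => ?_⟩
  obtain ⟨x, hx⟩ := exists_vecMul_abs_sub_le hM v
  set u := v - x ᵥ* M with hu
  have hxM : x ᵥ* M ∈ rowSpan M := mem_rowSpan.2 ⟨x, rfl⟩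
  have huC : reduction n q u ∈ C := AddSubgroup.sub_mem (C.comap (reduction n q)) hv (hle hxM)
  -- The remainder `u` reduces to a codeword within distance `e` of the codeword `0`, so
  -- disjointness of the balls forces them to coincide.
  have hu0 : reduction n q u = 0 := by
    by_contra hne
    have hd : Disjoint (ball (0 : Fin n → ZMod q) e) (ball (reduction n q u) e) :=
      hC.1.2.1.1 C.zero_mem huC (Ne.symm hne)
    refine Set.disjoint_left.1 hd (?_ : reduction n q u ∈ _) ?_
    · exact Finset.sup_le fun i _ => leeDist_zero_intCast_le (hx i)
    · simp [ball, maxDist, leeDist]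
  have : u = 0 := by
    ext i
    have h1 : (u i : ZMod q) = 0 := congrFun hu0 i
    rw [ZMod.intCast_zmod_eq_zero_iff_dvd] at h1
    exact Int.eq_zero_of_abs_lt_dvd h1 ((hx i).trans_lt (by exact_mod_cast hqe))
  rw [sub_eq_zero.1 (hu ▸ this : v - x ᵥ* M = 0)]
  exact hxM

/-! ### Counting reduced matrices -/

theorem card_reducedMatrices (n e : ℕ) :
    Nat.card (reducedMatrices n e) = (2 * e + 1) ^ n.choose 2 := by
  classical
  let E : reducedMatrices n e ≃
      ({p : Fin n × Fin n // p.1 < p.2} → Set.Icc (-(e : ℤ)) e) :=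
    { toFun := fun M p => ⟨M.1 p.1.1 p.1.2, abs_le.1 (M.2.2.2 _ _ p.2)⟩
      invFun := fun g => ⟨Matrix.of fun i j =>
          if h : i < j then (g ⟨(i, j), h⟩).1 else if i = j then 2 * e + 1 else 0, by
        refine ⟨fun i j h => ?_, fun i => ?_, fun i j h => ?_⟩
        · simp [not_lt.2 h.le, h.ne']
        · simp
        · simpa [h] using abs_le.2 (g ⟨(i, j), h⟩).2⟩
      left_inv := fun M => by
        ext i j
        rcases lt_trichotomy i j with h | rfl | h
        · simp [h]
        · simp [M.2.2.1]
        · simp [not_lt.2 h.le, h.ne', M.2.1 i j h]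
      right_inv := fun g => by
        ext ⟨⟨i, j⟩, h⟩
        have h' : i < j := h
        simp [h'] }
  rw [Nat.card_congr E, Nat.card_fun]
  congr 1
  · simp
    omega
  · rw [Nat.card_eq_fintype_card, Fintype.card_subtype, Fintype.card_product_filter_lt,
      Fintype.card_fin]

/-! ### Triangularization and factorization modulo `q` -/

/-- Unimodular column operations can clear the entries to the right of the diagonal in the rows
before `k`. -/
theorem exists_mul_lower_rows (F : Matrix (Fin n) (Fin n) ℤ) (k : ℕ) (hk : k ≤ n) :
    ∃ W : Matrix (Fin n) (Fin n) ℤ, IsUnit W.det ∧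
      ∀ i j : Fin n, i.1 < k → i < j → (F * W) i j = 0 := by
  induction k with
  | zero => exact ⟨1, by simp, fun i j h => absurd h (Nat.not_lt_zero _)⟩
  | succ k ih =>
    classical
    let κ : Fin n := ⟨k, hk⟩
    let S : Set (Matrix (Fin n) (Fin n) ℤ) :=
      {W | IsUnit W.det ∧ ∀ i j : Fin n, i.1 < k → i < j → (F * W) i j = 0}
    -- The pivot weighs less, so swapping a nonzero entry into a zero pivot lowers the weighted sum
    -- `μ`.
    let wt : Fin n → ℕ := fun j => if j = κ then 1 else 2
    have wt_pos : ∀ j, 0 < wt j := fun j => by simp only [wt]; split_ifs <;> simp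
    let μ : Matrix (Fin n) (Fin n) ℤ → ℕ := fun W =>
      ∑ j ∈ Finset.Ici κ, wt j * ((F * W) κ j).natAbs
    have hS : S.Nonempty := ih (by omega)
    obtain ⟨W, hWS, hmin⟩ : ∃ W ∈ S, ∀ W' ∈ S, μ W ≤ μ W' := by
      obtain ⟨W, hW, h⟩ := (measure μ).wf.has_min S hS
      exact ⟨W, hW, fun W' h' => not_lt.1 (h W' h')⟩
    -- subtracting a multiple of one column from another one cannot decrease an entry
    have hsub : ∀ a b : Fin n, κ ≤ a → κ ≤ b → a ≠ b → ∀ c : ℤ,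
        ((F * W) κ a).natAbs ≤ ((F * W) κ a + (F * W) κ b * c).natAbs := by
      intro a b ha hb hab c
      by_contra hlt
      have hcol : ∀ i j, (F * (W * transvection b a c)) i j =
          if j = a then (F * W) i a + (F * W) i b * c else (F * W) i j := by
        intro i j
        rw [← Matrix.mul_assoc]
        split_ifs with h
        · subst h
          rw [Matrix.mul_transvection_apply_same, mul_comm c]
        · rw [Matrix.mul_transvection_apply_of_ne _ _ _ _ h]
      refine absurd (hmin (W * transvection b a c) ⟨?_, ?_⟩) (not_le.2 ?_)
      · rw [Matrix.det_mul, Matrix.det_transvection_of_ne _ _ hab.symm, mul_one]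
        exact hWS.1
      · intro i j hi hij
        rw [hcol]
        have hia : i < a := lt_of_lt_of_le (Fin.lt_def.2 hi) ha
        have hib : i < b := lt_of_lt_of_le (Fin.lt_def.2 hi) hb
        split_ifs
        · rw [hWS.2 i a hi hia, hWS.2 i b hi hib]; simp
        · exact hWS.2 i j hi hij
      · refine Finset.sum_lt_sum (fun j _ => ?_) ⟨a, Finset.mem_Ici.2 ha, ?_⟩
        · rw [hcol]
          split_ifs with h
          · subst h
            exact Nat.mul_le_mul_left _ (not_le.1 hlt).le
          · exact le_rfl
        · rw [hcol, if_pos rfl]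
          exact Nat.mul_lt_mul_of_pos_left (not_le.1 hlt) (wt_pos a)
    refine ⟨W, hWS.1, fun i j hi hij => ?_⟩
    rcases Nat.lt_succ_iff_lt_or_eq.1 hi with h | h
    · exact hWS.2 i j h hij
    obtain rfl : i = κ := Fin.ext h
    by_contra hj
    by_cases h0 : (F * W) κ κ = 0
    · let σ : Equiv.Perm (Fin n) := Equiv.swap κ j
      have hcol : ∀ i l, (F * W.submatrix id σ) i l = (F * W) i (σ l) := fun i l => rfl
      refine absurd (hmin (W.submatrix id σ) ⟨?_, ?_⟩) (not_le.2 ?_)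
      · rw [Matrix.det_permute']
        exact (((Equiv.Perm.sign σ).isUnit).map (Int.castRingHom ℤ)).mul hWS.1
      · intro i l hi hil
        rw [hcol]
        refine hWS.2 i _ hi ?_
        have : i < κ := Fin.lt_def.2 hi
        simp only [σ, Equiv.swap_apply_def]
        split_ifs
        · exact this.trans hij
        · exact this
        · exact hil
      · have h1 : ∀ W' : Matrix (Fin n) (Fin n) ℤ, μ W' = ((F * W') κ κ).natAbs +
            (2 * ((F * W') κ j).natAbs + ∑ l ∈ ((Finset.Ici κ).erase κ).erase j,
              wt l * ((F * W') κ l).natAbs) := by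
          intro W'
          have e1 : κ ∈ Finset.Ici κ := by simp
          have e2 : j ∈ (Finset.Ici κ).erase κ := by simpa [hij.ne'] using hij
          simp only [μ]
          rw [← Finset.add_sum_erase _ _ e1, ← Finset.add_sum_erase _ _ e2]
          simp [wt, hij.ne']
        rw [h1, h1, hcol, hcol, Equiv.swap_apply_left, Equiv.swap_apply_right, h0]
        have h2 : ∑ l ∈ ((Finset.Ici κ).erase κ).erase j,
              wt l * ((F * W.submatrix id σ) κ l).natAbs =
            ∑ l ∈ ((Finset.Ici κ).erase κ).erase j, wt l * ((F * W) κ l).natAbs := by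
          refine Finset.sum_congr rfl fun l hl => ?_
          simp only [Finset.mem_erase] at hl
          rw [hcol, Equiv.swap_apply_of_ne_of_ne hl.2.1 hl.1]
        rw [h2]
        omega
    -- With both entries nonzero, adding or subtracting the smaller one in absolute value would
    -- shrink the larger, against minimality.
    · have hκj : κ ≠ j := hij.ne
      have a1 := hsub j κ hij.le le_rfl hκj.symm 1
      have a2 := hsub j κ hij.le le_rfl hκj.symm (-1)
      have b1 := hsub κ j le_rfl hij.le hκj 1
      have b2 := hsub κ j le_rfl hij.le hκj (-1)
      omega

/-- Every integer matrix becomes lower triangular after unimodular column operations. -/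
theorem exists_mul_lowerTriangular (F : Matrix (Fin n) (Fin n) ℤ) :
    ∃ W : Matrix (Fin n) (Fin n) ℤ, IsUnit W.det ∧ ∀ i j : Fin n, i < j → (F * W) i j = 0 := by
  obtain ⟨W, hW, h⟩ := exists_mul_lower_rows F n le_rfl
  exact ⟨W, hW, fun i j => h i j i.2⟩

/-- An invertible matrix over `ZMod q` is the product of a diagonal matrix and the reduction of a
unimodular integer matrix. -/
theorem exists_eq_diagonal_mul_map {q : ℕ} (A : Matrix (Fin n) (Fin n) (ZMod q))
    (hA : IsUnit A.det) :
    ∃ (d : Fin n → (ZMod q)ˣ) (Q : Matrix (Fin n) (Fin n) ℤ), IsUnit Q.det ∧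
      ∀ i j, A i j = d i * (Q i j : ZMod q) := by
  choose F hF using fun i j => ZMod.intCast_surjective (A i j)
  have hFA : (Int.castRingHom (ZMod q)).mapMatrix (Matrix.of F) = A := by
    ext i j; exact hF i j
  obtain ⟨W, hW, hT⟩ := exists_mul_lowerTriangular (Matrix.of F)
  set T := Matrix.of F * W with hTdef
  have hFT : Matrix.of F = T * W⁻¹ := by
    rw [hTdef, Matrix.mul_nonsing_inv_cancel_right _ _ hW]
  have hdet : IsUnit ((T.det : ℤ) : ZMod q) := by
    rw [hTdef, Matrix.det_mul, Int.cast_mul]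
    refine IsUnit.mul ?_ (hW.map (Int.castRingHom (ZMod q)))
    have := (Int.castRingHom (ZMod q)).map_det (Matrix.of F)
    rw [hFA] at this
    rw [← this] at hA
    exact hA
  have hTl : T.BlockTriangular OrderDual.toDual := fun i j h => hT i j h
  rw [Matrix.det_of_isLowerTriangular T hTl, Int.cast_prod, IsUnit.prod_univ_iff] at hdet
  choose d hd using hdet
  -- Dividing row `i` by the unit `d i` modulo `q` allows a lift `T'` with diagonal exactly `1`,
  -- hence of determinant `1`.
  choose c hc using fun i j => ZMod.intCast_surjective (((d i)⁻¹ : (ZMod q)ˣ) * (T i j : ZMod q) : ZMod q)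
  let T' : Matrix (Fin n) (Fin n) ℤ :=
    Matrix.of fun i j => if i = j then 1 else if i < j then 0 else c i j
  have hT' : ∀ i j, (T i j : ZMod q) = d i * (T' i j : ZMod q) := by
    intro i j
    simp only [T', Matrix.of_apply]
    split_ifs with h1 h2
    · subst h1; simp [hd]
    · simp [hT i j h2]
    · rw [hc, Units.mul_inv_cancel_left]
  have hT'det : T'.det = 1 := by
    rw [Matrix.det_of_isLowerTriangular T' fun i j (h : i < j) => by simp [T', h, h.ne]]
    simp [T']
  refine ⟨d, T' * W⁻¹, ?_, fun i j => ?_⟩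
  · rw [Matrix.det_mul, hT'det, one_mul]
    exact Matrix.isUnit_nonsing_inv_det W hW
  · have h : F i j = (T * W⁻¹) i j := congrFun (congrFun hFT i) j
    rw [← hF, h, Matrix.mul_apply, Matrix.mul_apply, Int.cast_sum, Int.cast_sum, Finset.mul_sum]
    refine Finset.sum_congr rfl fun l _ => ?_
    rw [Int.cast_mul, Int.cast_mul, hT', mul_assoc]

/-! ### Row spans and unimodular matrices -/

theorem rowSpan_mul (M V : Matrix (Fin n) (Fin n) ℤ) :
    rowSpan (M * V) = (rowSpan M).map (Matrix.vecMulLinear V).toAddMonoidHom := by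
  ext v
  simp only [AddSubgroup.mem_map, mem_rowSpan]
  constructor
  · rintro ⟨x, rfl⟩
    exact ⟨x ᵥ* M, ⟨x, rfl⟩, by simp [Matrix.vecMul_vecMul]⟩
  · rintro ⟨_, ⟨x, rfl⟩, rfl⟩
    exact ⟨x, by simp [Matrix.vecMul_vecMul]⟩

theorem rowSpan_mul_left {U : Matrix (Fin n) (Fin n) ℤ} (hU : IsUnit U.det)
    (M : Matrix (Fin n) (Fin n) ℤ) : rowSpan (U * M) = rowSpan M := by
  ext v
  simp only [mem_rowSpan]
  constructor
  · rintro ⟨x, rfl⟩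
    exact ⟨x ᵥ* U, by simp [Matrix.vecMul_vecMul]⟩
  · rintro ⟨x, rfl⟩
    exact ⟨x ᵥ* U⁻¹, by rw [Matrix.vecMul_vecMul, Matrix.nonsing_inv_mul_cancel_left _ _ hU]⟩

theorem exists_eq_mul_of_rowSpan_le {M N : Matrix (Fin n) (Fin n) ℤ}
    (h : rowSpan M ≤ rowSpan N) : ∃ U : Matrix (Fin n) (Fin n) ℤ, M = U * N := by
  choose U hU using fun i => mem_rowSpan.1 (h (row_mem_rowSpan M i))
  refine ⟨Matrix.of U, ?_⟩
  ext i j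
  rw [← hU i]
  rfl

theorem exists_unimodular_mul_of_rowSpan_eq {M N : Matrix (Fin n) (Fin n) ℤ} (hM : M.det ≠ 0)
    (h : rowSpan M = rowSpan N) : ∃ U : Matrix (Fin n) (Fin n) ℤ, IsUnit U.det ∧ M = U * N := by
  obtain ⟨U, hU⟩ := exists_eq_mul_of_rowSpan_le h.le
  obtain ⟨U', hU'⟩ := exists_eq_mul_of_rowSpan_le h.ge
  refine ⟨U, ?_, hU⟩
  have h1 : M.det = U.det * (U'.det * M.det) := by
    rw [← Matrix.det_mul U' M, ← hU', ← Matrix.det_mul, ← hU]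
  refine IsUnit.of_mul_eq_one U'.det (mul_right_cancel₀ hM ?_)
  rw [one_mul, mul_assoc, ← h1]

theorem det_ne_zero_of_mem_reducedMatrices {e : ℕ} {M : Matrix (Fin n) (Fin n) ℤ}
    (hM : M ∈ reducedMatrices n e) : M.det ≠ 0 := by
  rw [Matrix.det_of_isUpperTriangular fun i j h => hM.1 i j h, Finset.prod_ne_zero_iff]
  intro i _
  rw [hM.2.1]
  omega

theorem reduction_eq_zero_iff {q : ℕ} {v : Fin n → ℤ} :
    reduction n q v = 0 ↔ ∃ y : Fin n → ℤ, v = (q : ℤ) • y := by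
  constructor
  · intro h
    have h1 : ∀ i, ∃ y : ℤ, v i = q * y := fun i =>
      (ZMod.intCast_zmod_eq_zero_iff_dvd _ _).1 (congrFun h i)
    choose y hy using h1
    exact ⟨y, funext hy⟩
  · rintro ⟨y, rfl⟩
    ext i
    simp

theorem mem_of_reduction_mem {q : ℕ} {L : AddSubgroup (Fin n → ℤ)}
    (hL : ∀ v : Fin n → ℤ, (q : ℤ) • v ∈ L) {v : Fin n → ℤ}
    (hv : reduction n q v ∈ L.map (reduction n q)) : v ∈ L := by
  obtain ⟨w, hw, hwv⟩ := hv
  have h : reduction n q (v - w) = 0 := by rw [map_sub, hwv, sub_self]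
  obtain ⟨y, hy⟩ := reduction_eq_zero_iff.1 h
  rw [← sub_add_cancel v w, hy]
  exact L.add_mem (hL y) hw

/-- The matrix whose rows are the images of a basis of `ℤ ^ n` under the reduction followed by an
automorphism of `(ZMod q) ^ n` is invertible. -/
theorem isUnit_det_of_basis_reduction {q : ℕ} (b : Module.Basis (Fin n) ℤ (Fin n → ℤ))
    (f : (Fin n → ZMod q) ≃+ (Fin n → ZMod q)) :
    IsUnit (Matrix.of fun i => f (reduction n q (b i))).det := by
  -- Expanding lifts of the `f.symm`-images of the standard basis in `b` gives the rows of a left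
  -- inverse.
  choose u hu using fun j : Fin n => reduction_surjective n q (f.symm (Pi.single j 1))
  refine Matrix.isUnit_det_of_left_inverse
    (B := Matrix.of fun j i => ((b.repr (u j) i : ℤ) : ZMod q)) ?_
  ext j l
  have h1 : f (reduction n q (u j)) = Pi.single j 1 := by rw [hu, f.apply_symm_apply]
  rw [← b.sum_repr (u j), map_sum, map_sum] at h1
  have h2 := congrFun h1 l
  rw [Finset.sum_apply] at h2
  rw [Matrix.mul_apply, Matrix.one_eq_pi_single, ← h2]
  refine Finset.sum_congr rfl fun i _ => ?_
  rw [map_zsmul, map_zsmul, Pi.smul_apply, zsmul_eq_mul]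
  rfl

theorem isUnit_det_of_basis (b : Module.Basis (Fin n) ℤ (Fin n → ℤ)) :
    IsUnit (Matrix.of fun i => b i).det := by
  refine Matrix.isUnit_det_of_left_inverse
    (B := Matrix.of fun j i => b.repr (Pi.single j 1) i) ?_
  ext j l
  have h := congrFun (b.sum_repr (Pi.single j 1)) l
  rw [Finset.sum_apply] at h
  rw [Matrix.mul_apply, Matrix.one_eq_pi_single, ← h]
  rfl

/-- If an automorphism of `(ZMod q) ^ n` maps one row span to another one modulo `q`, then so does a
unimodular integer matrix, before the reduction. -/
theorem exists_unimodular_rowSpan_eq {q : ℕ} {M N : Matrix (Fin n) (Fin n) ℤ}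
    (hM : ∀ v : Fin n → ℤ, (q : ℤ) • v ∈ rowSpan M)
    (hN : ∀ v : Fin n → ℤ, (q : ℤ) • v ∈ rowSpan N)
    (f : (Fin n → ZMod q) ≃+ (Fin n → ZMod q))
    (h : (rowSpan M).map (reduction n q) =
      ((rowSpan N).map (reduction n q)).map f.toAddMonoidHom) :
    ∃ V : Matrix (Fin n) (Fin n) ℤ, IsUnit V.det ∧ rowSpan M = rowSpan (N * V) := by
  obtain ⟨m, b, bN, φ, a, hsnf⟩ :=
    (AddSubgroup.toIntSubmodule (rowSpan N)).smithNormalForm (Pi.basisFun ℤ (Fin n))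
  obtain ⟨d, Q, hQ, hdQ⟩ := exists_eq_diagonal_mul_map _ (isUnit_det_of_basis_reduction b f)
  set P : Matrix (Fin n) (Fin n) ℤ := Matrix.of fun i => b i with hP
  have hPdet : IsUnit P.det := isUnit_det_of_basis b
  set V := P⁻¹ * Q with hV
  -- Modulo `q`, `f` sends `b i` to `d i` times `b i ᵥ* V`, so `V` realizes `f` up to scaling.
  have hVdet : IsUnit V.det := by
    rw [hV, Matrix.det_mul]
    exact (Matrix.isUnit_nonsing_inv_det P hPdet).mul hQ
  have hbV : ∀ i, b i ᵥ* V = Q i := by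
    intro i
    have : P * V = Q := by rw [hV, Matrix.mul_nonsing_inv_cancel_left _ _ hPdet]
    conv_rhs => rw [← this]
    rfl
  -- scaling the basis vectors preserves the row span of `N`
  let δ : (Fin n → ℤ) → (Fin n → ℤ) →ₗ[ℤ] (Fin n → ℤ) := fun c => b.constr ℤ fun i => c i • b i
  have hδ : ∀ c i, δ c (b i) = c i • b i := fun c i => b.constr_basis ℤ _ i
  have hδN : ∀ c, ∀ w ∈ rowSpan N, δ c w ∈ rowSpan N := by
    intro c w hw
    have h1 := congrArg Subtype.val (bN.sum_repr ⟨w, hw⟩)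
    simp only [AddSubmonoidClass.coe_finsetSum, SetLike.val_smul] at h1
    rw [← h1, map_sum]
    refine AddSubgroup.sum_mem _ fun j _ => ?_
    rw [map_smul, hsnf, map_smul, hδ, smul_comm (a j), ← hsnf]
    exact AddSubgroup.zsmul_mem _ (AddSubgroup.zsmul_mem _ (bN j).2 _) _
  choose d₁ hd₁ using fun i => ZMod.intCast_surjective (d i : ZMod q)
  choose d₂ hd₂ using fun i => ZMod.intCast_surjective (((d i)⁻¹ : (ZMod q)ˣ) : ZMod q)
  have key : ∀ c₁ c₂ : Fin n → ℤ, (∀ i, (c₁ i : ZMod q) * d i = c₂ i) → ∀ w,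
      f (reduction n q (δ c₁ w)) = reduction n q (δ c₂ w ᵥ* V) := by
    intro c₁ c₂ hc w
    rw [← b.sum_repr w]
    simp only [map_sum, Matrix.sum_vecMul, map_smul, hδ, Matrix.smul_vecMul, hbV]
    refine Finset.sum_congr rfl fun i _ => ?_
    rw [map_zsmul, map_zsmul, map_zsmul, map_zsmul, map_zsmul, map_zsmul]
    congr 1
    ext j
    have := hdQ i j
    rw [Matrix.of_apply] at this
    simp only [Pi.smul_apply, zsmul_eq_mul, reduction_apply, this, ← mul_assoc, hc]
  have hδ1 : ∀ w, δ 1 w = w := fun w => by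
    have : δ 1 = LinearMap.id := b.ext fun i => by simp [hδ]
    rw [this]; rfl
  refine ⟨V, hVdet, ?_⟩
  rw [rowSpan_mul]
  apply le_antisymm
  · intro v hv
    have h1 : reduction n q v ∈ (rowSpan M).map (reduction n q) := ⟨v, hv, rfl⟩
    rw [h] at h1
    obtain ⟨_, ⟨w, hw, rfl⟩, hwv⟩ := h1
    have h2 := key 1 d₁ (fun i => by simp [hd₁]) w
    rw [hδ1] at h2
    have h3 : reduction n q (v - δ d₁ w ᵥ* V) = 0 := by
      rw [map_sub, ← h2, ← hwv]
      exact sub_self _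
    obtain ⟨y, hy⟩ := reduction_eq_zero_iff.1 h3
    -- The error `q • y` is pulled back through `V` to a multiple of `q`, which lies in `rowSpan N`
    -- by `hN`.
    refine ⟨(q : ℤ) • (y ᵥ* V⁻¹) + δ d₁ w, (rowSpan N).add_mem (hN _) (hδN _ _ hw), ?_⟩
    change ((q : ℤ) • (y ᵥ* V⁻¹) + δ d₁ w) ᵥ* V = v
    rw [Matrix.add_vecMul, Matrix.smul_vecMul, Matrix.vecMul_vecMul,
      Matrix.nonsing_inv_mul _ hVdet, Matrix.vecMul_one, ← hy, sub_add_cancel]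
  · rintro _ ⟨w, hw, rfl⟩
    apply mem_of_reduction_mem hM
    rw [h]
    -- Scaling `w` first by lifts of the inverse units cancels the factors `d i`.
    have h2 := key d₂ 1 (fun i => by simp [hd₂]) w
    rw [hδ1] at h2
    exact ⟨_, ⟨_, hδN d₂ w hw, rfl⟩, h2⟩

/-- The automorphism of `(ZMod q) ^ n` induced by a unimodular integer matrix. -/
noncomputable def vecMulAddEquiv (q : ℕ) (V : Matrix (Fin n) (Fin n) ℤ) (hV : IsUnit V.det) :
    (Fin n → ZMod q) ≃+ (Fin n → ZMod q) where
  toFun x := x ᵥ* V.map (Int.castRingHom (ZMod q))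
  invFun x := x ᵥ* (V⁻¹).map (Int.castRingHom (ZMod q))
  left_inv x := by
    beta_reduce
    rw [Matrix.vecMul_vecMul, ← Matrix.map_mul, Matrix.mul_nonsing_inv _ hV]
    simp
  right_inv x := by
    beta_reduce
    rw [Matrix.vecMul_vecMul, ← Matrix.map_mul, Matrix.nonsing_inv_mul _ hV]
    simp
  map_add' x y := Matrix.add_vecMul _ _ _

theorem map_reduction_rowSpan_mul (q : ℕ) (M V : Matrix (Fin n) (Fin n) ℤ) (hV : IsUnit V.det) :
    (rowSpan (M * V)).map (reduction n q) =
      ((rowSpan M).map (reduction n q)).map (vecMulAddEquiv q V hV).toAddMonoidHom := by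
  rw [rowSpan_mul, AddSubgroup.map_map, AddSubgroup.map_map]
  congr 1
  refine AddMonoidHom.ext fun v => funext fun j => ?_
  simp [vecMulAddEquiv, Matrix.vecMul, dotProduct]

/-- Unimodular equivalence of matrices amounts to algebraic equivalence of the codes that they
define. -/
theorem gammaEquiv_iff_exists_addEquiv {q : ℕ} {M N : Matrix (Fin n) (Fin n) ℤ} (hdet : M.det ≠ 0)
    (hM : ∀ v : Fin n → ℤ, (q : ℤ) • v ∈ rowSpan M)
    (hN : ∀ v : Fin n → ℤ, (q : ℤ) • v ∈ rowSpan N) :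
    GammaEquiv M N ↔ ∃ f : (Fin n → ZMod q) ≃+ (Fin n → ZMod q),
      (rowSpan M).map (reduction n q) =
        ((rowSpan N).map (reduction n q)).map f.toAddMonoidHom := by
  constructor
  · rintro ⟨U, V, hU, hV, rfl⟩
    rw [isUnimodular_iff] at hU hV
    refine ⟨vecMulAddEquiv q V hV, ?_⟩
    rw [Matrix.mul_assoc, rowSpan_mul_left hU, map_reduction_rowSpan_mul]
  · rintro ⟨f, hf⟩
    obtain ⟨V, hV, h⟩ := exists_unimodular_rowSpan_eq hM hN f hf
    obtain ⟨U, hU, h'⟩ := exists_unimodular_mul_of_rowSpan_eq hdet h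
    exact ⟨U, V, (isUnimodular_iff U).2 hU, (isUnimodular_iff V).2 hV, by
      rw [h', Matrix.mul_assoc]⟩

end MaxMetricCode

/-! ### The two bijections -/

open MaxMetricCode in
theorem mainTheorem7 (n e t q : ℕ) (hn : 1 ≤ n) (ht : 1 < t) (hq : q = (2 * e + 1) * t)
    (hmax : MaxMetricCode.IsMaximalPair n q e) :
    ∃ ψ : MaxMetricCode.reducedMatrices n e → MaxMetricCode.orderedCodes n q e,
      (∀ M : MaxMetricCode.reducedMatrices n e,
        (∀ v : Fin n → ℤ, (q : ℤ) • v ∈ MaxMetricCode.rowSpan M.1) ∧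
        (ψ M).1 = (MaxMetricCode.rowSpan M.1).map (MaxMetricCode.reduction n q)) ∧
      Function.Bijective ψ ∧
      ∃ ψA : Quotient (MaxMetricCode.gammaSetoid n e) → Quotient (MaxMetricCode.algSetoid n q e),
        (∀ M : MaxMetricCode.reducedMatrices n e,
          ψA (Quotient.mk (MaxMetricCode.gammaSetoid n e) M) =
            Quotient.mk (MaxMetricCode.algSetoid n q e) (ψ M)) ∧
        Function.Bijective ψA := by
  choose μ hμ hspan using fun C : orderedCodes n q e => exists_reducedMatrix_of_ordered ht hq C.2
  let g : orderedCodes n q e → reducedMatrices n e := fun C => ⟨μ C, hμ C⟩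
  have hginj : Function.Injective g := by
    intro C₁ C₂ h
    apply Subtype.ext
    apply AddSubgroup.comap_injective (reduction_surjective n q)
    rw [← hspan, ← hspan, show μ C₁ = μ C₂ from congrArg Subtype.val h]
  have hpos : Nat.card (reducedMatrices n e) ≠ 0 := by
    rw [card_reducedMatrices]; positivity
  have : Finite (reducedMatrices n e) := Nat.finite_of_card_ne_zero hpos
  -- Maximality enters here: an injection into a finite set of no larger cardinality is onto.
  have hg : Function.Bijective g :=
    hginj.bijective_of_nat_card_le (by rw [card_reducedMatrices]; exact hmax.ge)
  let E := Equiv.ofBijective g hg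
  have hE : ∀ M : reducedMatrices n e,
      rowSpan M.1 = (E.symm M).1.comap (reduction n q) := by
    intro M
    rw [← hspan, show μ (E.symm M) = M.1 from congrArg Subtype.val (E.apply_symm_apply M)]
  have hψ : ∀ M : reducedMatrices n e,
      (∀ v : Fin n → ℤ, (q : ℤ) • v ∈ rowSpan M.1) ∧
        (E.symm M).1 = (rowSpan M.1).map (reduction n q) := by
    intro M
    rw [hE]
    refine ⟨fun v => ?_, ?_⟩
    · rw [AddSubgroup.mem_comap, reduction_eq_zero_iff.2 ⟨v, rfl⟩]
      exact AddSubgroup.zero_mem _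
    · rw [AddSubgroup.map_comap_eq_self_of_surjective (reduction_surjective n q)]
  have hiff : ∀ M N : reducedMatrices n e,
      gammaSetoid n e M N ↔ algSetoid n q e (E.symm M) (E.symm N) := by
    intro M N
    refine (gammaEquiv_iff_exists_addEquiv (det_ne_zero_of_mem_reducedMatrices M.2)
      (hψ M).1 (hψ N).1).trans ?_
    rw [← (hψ M).2, ← (hψ N).2]
    rfl
  refine ⟨E.symm, hψ, E.symm.bijective, Quotient.congr E.symm hiff, fun M => rfl,
    Equiv.bijective _⟩
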